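/- A weighted graph $G$ is a finite graph without loops or parallel edges, not necessarily connected, in which every edge $uv$ carries a positive weight $w_{uv}$. The weighted degree of a vertex is the sum of the weights of the edges incident to it, $G$ is $w$-regular if every vertex has weighted degree $w$, and the average combinatorial degree of $G$ is $2|E(G)|/|V(G)|$. Let $\lambda_i(G)$ denote the $i$-th largest eigenvalue, counted with multiplicity, of the weighted adjacency matrix of $G$, let $P_n$ be the path with $n$ vertices and all edge weights equal to $1$, and let $G(v,s)$ be the ball of radius $s$ centred at $v$, that is, the subgraph induced on the vertices at distance at most $s$ from $v$, where distance is the least number of edges of a connecting walk (and is infinite between different components). Theorem. Let $G$ be a $w$-regular weighted graph with average combinatorial degree $d\ge 39$ ($d$ real), and let $r$ be any positive integer. Assume that for every vertex $v$ the graph $G\setminus G(v,r+1)$, obtained from $G$ by deleting the vertices of the ball, has a non-empty induced subgraph in which every vertex has weighted degree (within that subgraph) at least $2w\sqrt{d-1}/d$. Then $$\frac{\lambda_2(G)}{\lambda_1(P_{r+1})}\ \ge\ \frac{w\sqrt{d-1}}{d}.$$ -/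

import Mathlib

/-- A weighted graph on the vertex set `V`: a graph without loops or parallel edges together with
a positive weight on every edge. The weight function is extended by `0` to the pairs of vertices
that are not edges. -/
structure WeightedGraph (V : Type*) where
  /-- the underlying graph -/
  graph : SimpleGraph V
  /-- the weight of the edge `uv`, and `0` if `uv` is not an edge -/
  weight : V → V → ℝ
  weight_symm : ∀ u v, weight u v = weight v u
  weight_pos : ∀ u v, graph.Adj u v → 0 < weight u v
  weight_zero : ∀ u v, ¬ graph.Adj u v → weight u v = 0

namespace WeightedGraph

variable {V : Type*}

/-- The weighted degree of `v`: the sum of the weights of the edges incident to `v`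
(pairs that are not edges contribute `0`). -/
def weightedDegree [Fintype V] (G : WeightedGraph V) (v : V) : ℝ :=
  ∑ u, G.weight v u

/-- `G` is `w`-regular: every vertex has weighted degree `w`. -/
def IsRegular [Fintype V] (G : WeightedGraph V) (w : ℝ) : Prop :=
  ∀ v, G.weightedDegree v = w

/-- The average combinatorial degree `2|E(G)| / |V(G)|`. -/
noncomputable def avgDegree [Fintype V] (G : WeightedGraph V) : ℝ :=
  2 * (G.graph.edgeSet.ncard : ℝ) / (Fintype.card V : ℝ)

/-- The vertex set of the ball of radius `r` centred at `v`: the vertices that can be reached from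
`v` by a walk with at most `r` edges (a vertex in another component has distance `⊤`). -/
def ball (G : WeightedGraph V) (v : V) (r : ℕ) : Set V :=
  {u | G.graph.edist v u ≤ (r : ℕ∞)}

/-- The induced weighted subgraph on a set `S` of vertices. -/
def induce (G : WeightedGraph V) (S : Set V) : WeightedGraph S where
  graph := G.graph.induce S
  weight u v := G.weight u v
  weight_symm u v := G.weight_symm u v
  weight_pos u v h := G.weight_pos u v h
  weight_zero u v h := G.weight_zero u v h

/-- The weighted adjacency matrix. -/
def adjMatrix (G : WeightedGraph V) : Matrix V V ℝ :=
  Matrix.of G.weight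

theorem adjMatrix_isHermitian (G : WeightedGraph V) : G.adjMatrix.IsHermitian := by
  ext u v
  simpa [adjMatrix] using G.weight_symm v u

/-- `G.eigenvalue i` is `λ_i(G)`, the `i`-th largest eigenvalue of the weighted adjacency matrix,
counted with multiplicity, for `1 ≤ i ≤ |V|` (and `0` for other `i`). -/
noncomputable def eigenvalue [Fintype V] [DecidableEq V] (G : WeightedGraph V) (i : ℕ) : ℝ :=
  if h : 1 ≤ i ∧ i ≤ Fintype.card V then
    G.adjMatrix_isHermitian.eigenvalues₀ ⟨i - 1, by omega⟩
  else 0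

open Classical in
/-- The weighted graph in which every edge of a given graph has weight `1`. -/
noncomputable def ofGraph (H : SimpleGraph V) : WeightedGraph V where
  graph := H
  weight u v := if H.Adj u v then 1 else 0
  weight_symm u v := by simp only [H.adj_comm]
  weight_pos u v h := by simp [h]
  weight_zero u v h := by simp [h]

/-- The path `P_n` with `n` vertices, all weights being `1`. -/
noncomputable def path (n : ℕ) : WeightedGraph (Fin n) :=
  ofGraph (SimpleGraph.pathGraph n)

end WeightedGraph

/-! Put `h = w√(d-1)/d` and `Λ = λ₁(P_{r+1})`, so that `Λ ≤ 2`. It suffices to find a vector `g`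
supported on some ball of radius `r` with Rayleigh quotient at least `hΛ`. The indicator of a
subgraph of minimum degree `2h` outside the ball of radius `r + 1` has Rayleigh quotient at least
`2h`. No edge joins the two supports, so the vectors are orthogonal also for the adjacency form, and
`le_eigenvalues₀_one` bounds `λ₂` from below.

If the squared weights at some vertex sum to more than `(2h)²`, its star supplies `g`
(`exists_star_vector`). Otherwise run the weighted non-backtracking walk from each directed edge,
weighted by the stationary measure. Let `g(u)²` be the sum of the masses at `u` after `0, ..., r`
steps, the `i`-th weighted by `x i ^ 2` with `x` a top eigenvector of the path. By Cauchy–Schwarz,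
`g u * g v` dominates the flows in both directions along `uv` (`sum_nbFlow_le`). Averaged over the
starting edges, everything becomes stationary, and some start succeeds (`exists_ball_vector`) once
the stationary flow is at least `h` times the total mass.

That bound is proved vertex by vertex (`local_flow_inequality`), with an error proportional to `d`
minus the degree of the vertex. These errors sum to zero because `d` is the average degree. -/

/-! ### Rayleigh quotients and the second eigenvalue of a real symmetric matrix. -/

section Spectral

open Matrix

variable {n : Type*} [Fintype n] [DecidableEq n] {A : Matrix n n ℝ}

namespace Matrix.IsHermitian

theorem sum_dotProduct_eigenvectorBasis (hA : A.IsHermitian) (x y : n → ℝ) :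
    ∑ j, (x ⬝ᵥ ⇑(hA.eigenvectorBasis j)) * (y ⬝ᵥ ⇑(hA.eigenvectorBasis j)) = x ⬝ᵥ y := by
  have h := hA.eigenvectorBasis.sum_inner_mul_inner (WithLp.toLp 2 x) (WithLp.toLp 2 y)
  simp only [EuclideanSpace.inner_eq_star_dotProduct, star_trivial] at h
  rw [dotProduct_comm x y, ← h]
  refine Finset.sum_congr rfl fun j _ => ?_
  rw [dotProduct_comm x]

theorem mulVec_dotProduct_eigenvectorBasis (hA : A.IsHermitian) (x : n → ℝ) (j : n) :
    (A *ᵥ x) ⬝ᵥ ⇑(hA.eigenvectorBasis j) =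
      hA.eigenvalues j * (x ⬝ᵥ ⇑(hA.eigenvectorBasis j)) := by
  have hT : Aᵀ = A := by simpa [conjTranspose_eq_transpose_of_trivial] using hA.eq
  rw [dotProduct_comm, dotProduct_mulVec, ← mulVec_transpose, hT, hA.mulVec_eigenvectorBasis,
    smul_dotProduct, smul_eq_mul, dotProduct_comm]

theorem dotProduct_mulVec_eq_sum (hA : A.IsHermitian) (x : n → ℝ) :
    x ⬝ᵥ A *ᵥ x = ∑ j, hA.eigenvalues j * (x ⬝ᵥ ⇑(hA.eigenvectorBasis j)) ^ 2 := by
  rw [← hA.sum_dotProduct_eigenvectorBasis x (A *ᵥ x)]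
  refine Finset.sum_congr rfl fun j _ => ?_
  rw [hA.mulVec_dotProduct_eigenvectorBasis]; ring

theorem dotProduct_self_eq_sum (hA : A.IsHermitian) (x : n → ℝ) :
    x ⬝ᵥ x = ∑ j, (x ⬝ᵥ ⇑(hA.eigenvectorBasis j)) ^ 2 := by
  rw [← hA.sum_dotProduct_eigenvectorBasis x x]
  exact Finset.sum_congr rfl fun j _ => (sq _).symm

/-- If `x` is orthogonal to the eigenvectors that come before the `i`-th one, its Rayleigh quotient
is at most the `i`-th eigenvalue. -/
theorem dotProduct_mulVec_le (hA : A.IsHermitian) (i : Fin (Fintype.card n)) (x : n → ℝ)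
    (hx : ∀ k < i, x ⬝ᵥ ⇑(hA.eigenvectorBasis (Fintype.equivOfCardEq (Fintype.card_fin _) k)) = 0) :
    x ⬝ᵥ A *ᵥ x ≤ hA.eigenvalues₀ i * (x ⬝ᵥ x) := by
  rw [hA.dotProduct_mulVec_eq_sum, hA.dotProduct_self_eq_sum, Finset.mul_sum]
  refine Finset.sum_le_sum fun j _ => ?_
  obtain ⟨k, rfl⟩ := (Fintype.equivOfCardEq (Fintype.card_fin (Fintype.card n))).surjective j
  rcases lt_or_ge k i with h | h
  · simp [hx k h]
  · have : hA.eigenvalues (Fintype.equivOfCardEq (Fintype.card_fin _) k) = hA.eigenvalues₀ k := by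
      simp [eigenvalues]
    rw [this]
    exact mul_le_mul_of_nonneg_right (hA.eigenvalues₀_antitone h) (sq_nonneg _)

theorem exists_mulVec_eq_eigenvalues₀ (hA : A.IsHermitian) (i : Fin (Fintype.card n)) :
    ∃ x : n → ℝ, x ≠ 0 ∧ A *ᵥ x = hA.eigenvalues₀ i • x := by
  refine ⟨⇑(hA.eigenvectorBasis (Fintype.equivOfCardEq (Fintype.card_fin _) i)), ?_, ?_⟩
  · intro h
    have h1 := hA.eigenvectorBasis.orthonormal.ne_zero
      (Fintype.equivOfCardEq (Fintype.card_fin _) i)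
    exact h1 (by ext j; exact congrFun h j)
  · rw [hA.mulVec_eigenvectorBasis]; simp [eigenvalues]

/-- Two vectors that are orthogonal, both for the standard form and for `A`, and whose Rayleigh
quotients are at least `θ`, force the second eigenvalue to be at least `θ`. -/
theorem le_eigenvalues₀_one (hA : A.IsHermitian) (hn : 1 < Fintype.card n) {θ : ℝ} {g s : n → ℝ}
    (hg : g ≠ 0) (hs : s ≠ 0) (hgs : g ⬝ᵥ s = 0) (hAgs : g ⬝ᵥ A *ᵥ s = 0)
    (hgθ : θ * (g ⬝ᵥ g) ≤ g ⬝ᵥ A *ᵥ g) (hsθ : θ * (s ⬝ᵥ s) ≤ s ⬝ᵥ A *ᵥ s) :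
    θ ≤ hA.eigenvalues₀ ⟨1, hn⟩ := by
  set e : n → ℝ := ⇑(hA.eigenvectorBasis (Fintype.equivOfCardEq (Fintype.card_fin _)
    (⟨0, by omega⟩ : Fin (Fintype.card n)))) with he
  have hgg : 0 < g ⬝ᵥ g := by
    refine lt_of_le_of_ne (Finset.sum_nonneg fun i _ => mul_self_nonneg _) fun h => hg ?_
    exact dotProduct_self_eq_zero.1 h.symm
  have hss : 0 < s ⬝ᵥ s := by
    refine lt_of_le_of_ne (Finset.sum_nonneg fun i _ => mul_self_nonneg _) fun h => hs ?_
    exact dotProduct_self_eq_zero.1 h.symm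
  have hT : Aᵀ = A := by simpa [conjTranspose_eq_transpose_of_trivial] using hA.eq
  have hAsg : s ⬝ᵥ A *ᵥ g = 0 := by
    rw [dotProduct_mulVec, ← mulVec_transpose, hT, dotProduct_comm]; exact hAgs
  have key : ∀ a b : ℝ, a * (g ⬝ᵥ e) + b * (s ⬝ᵥ e) = 0 →
      θ * (a ^ 2 * (g ⬝ᵥ g) + b ^ 2 * (s ⬝ᵥ s)) ≤
        hA.eigenvalues₀ ⟨1, hn⟩ * (a ^ 2 * (g ⬝ᵥ g) + b ^ 2 * (s ⬝ᵥ s)) := by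
    intro a b hab
    have h := hA.dotProduct_mulVec_le ⟨1, hn⟩ (a • g + b • s) (by
      intro k hk
      have hk0 : k = ⟨0, by omega⟩ := by
        apply Fin.ext; have := Fin.lt_def.1 hk; simp at this ⊢; omega
      rw [hk0, ← he, add_dotProduct, smul_dotProduct, smul_dotProduct]
      simpa using hab)
    have hsg : s ⬝ᵥ g = 0 := by rw [dotProduct_comm]; exact hgs
    simp only [mulVec_add, mulVec_smul, add_dotProduct, dotProduct_add, smul_dotProduct,
      dotProduct_smul, smul_eq_mul, hgs, hsg, hAgs, hAsg] at h
    nlinarith [mul_le_mul_of_nonneg_left hgθ (sq_nonneg a),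
      mul_le_mul_of_nonneg_left hsθ (sq_nonneg b)]
  -- Some nonzero combination of `g` and `s` is orthogonal to the top eigenvector `e`: `g` itself,
  -- or else `-(s ⬝ᵥ e) g + (g ⬝ᵥ e) s`.
  by_cases h0 : g ⬝ᵥ e = 0
  · have h := key 1 0 (by simp [h0])
    refine le_of_mul_le_mul_right (a := g ⬝ᵥ g) ?_ hgg
    simpa using h
  · refine le_of_mul_le_mul_right (key (-(s ⬝ᵥ e)) (g ⬝ᵥ e) (by ring)) ?_
    have : 0 < (g ⬝ᵥ e) ^ 2 := by positivity
    nlinarith [mul_pos this hss, mul_nonneg (sq_nonneg (-(s ⬝ᵥ e))) hgg.le]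

end Matrix.IsHermitian

end Spectral

/-! ### The adjacency form, and the top eigenvalue of a path. -/

namespace WeightedGraph

open Matrix

theorem dotProduct_adjMatrix_mulVec {V : Type*} [Fintype V] (G : WeightedGraph V) (x : V → ℝ) :
    x ⬝ᵥ G.adjMatrix *ᵥ x = ∑ u, ∑ v, G.weight u v * (x u * x v) := by
  simp only [dotProduct, mulVec, adjMatrix, of_apply, Finset.mul_sum]
  exact Finset.sum_congr rfl fun u _ => Finset.sum_congr rfl fun v _ => by ring

theorem weight_nonneg {V : Type*} (G : WeightedGraph V) (u v : V) : 0 ≤ G.weight u v := by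
  by_cases h : G.graph.Adj u v
  · exact (G.weight_pos u v h).le
  · exact (G.weight_zero u v h).ge

theorem sum_path_weight (m : ℕ) (f : ℕ → ℕ → ℝ) (hf : ∀ i j, f i j = f j i) :
    ∑ u : Fin (m + 1), ∑ v : Fin (m + 1), (path (m + 1)).weight u v * f u v =
      2 * ∑ i ∈ Finset.range m, f i (i + 1) := by
  classical
  have hw : ∀ u v : Fin (m + 1), (path (m + 1)).weight u v =
      (if (u : ℕ) + 1 = v then 1 else 0) + (if (v : ℕ) + 1 = u then 1 else 0) := by
    intro u v
    simp only [path, ofGraph, SimpleGraph.pathGraph_adj]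
    split_ifs <;> first | omega | norm_num
  have h1 : ∑ u : Fin (m + 1), ∑ v : Fin (m + 1), (if (u : ℕ) + 1 = v then (1 : ℝ) else 0) * f u v =
      ∑ i ∈ Finset.range m, f i (i + 1) := by
    have : ∀ u : Fin (m + 1), ∑ v : Fin (m + 1), (if (u : ℕ) + 1 = v then (1 : ℝ) else 0) * f u v =
        if (u : ℕ) < m then f u (u + 1) else 0 := by
      intro u
      rw [Fin.sum_univ_eq_sum_range
        (fun v => (if (u : ℕ) + 1 = v then (1 : ℝ) else 0) * f u v) (m + 1)]
      simp
    rw [Finset.sum_congr rfl fun u _ => this u,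
      Fin.sum_univ_eq_sum_range (fun u => if u < m then f u (u + 1) else 0) (m + 1),
      Finset.sum_range_succ]
    simp only [lt_irrefl, if_false, add_zero]
    exact Finset.sum_congr rfl fun i hi => if_pos (Finset.mem_range.1 hi)
  have h2 : ∑ u : Fin (m + 1), ∑ v : Fin (m + 1), (if (v : ℕ) + 1 = u then (1 : ℝ) else 0) * f u v =
      ∑ i ∈ Finset.range m, f i (i + 1) := by
    rw [Finset.sum_comm, ← h1]
    refine Finset.sum_congr rfl fun u _ => Finset.sum_congr rfl fun v _ => ?_
    rw [hf]
  simp only [hw, add_mul, Finset.sum_add_distrib, h1, h2]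
  ring

/-- The largest eigenvalue of a path with at least two vertices lies in `(0, 2]` and has a
nonnegative test vector. -/
theorem exists_path_eigenvalue (r : ℕ) (hr : 1 ≤ r) :
    0 < (path (r + 1)).eigenvalue 1 ∧ (path (r + 1)).eigenvalue 1 ≤ 2 ∧
    ∃ x : ℕ → ℝ, (∀ i, 0 ≤ x i) ∧ 0 < ∑ i ∈ Finset.range (r + 1), x i ^ 2 ∧
      (path (r + 1)).eigenvalue 1 * ∑ i ∈ Finset.range (r + 1), x i ^ 2 ≤
        2 * ∑ i ∈ Finset.range r, x i * x (i + 1) := by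
  set P := path (r + 1)
  have hc : 0 < Fintype.card (Fin (r + 1)) := by simp
  have hP : P.eigenvalue 1 = P.adjMatrix_isHermitian.eigenvalues₀ ⟨0, hc⟩ := by
    have : 1 ≤ 1 ∧ 1 ≤ Fintype.card (Fin (r + 1)) := by simp
    rw [eigenvalue, dif_pos this]
  rw [hP]
  set μ := P.adjMatrix_isHermitian.eigenvalues₀ ⟨0, hc⟩
  have form : ∀ y : ℕ → ℝ, (fun i : Fin (r + 1) => y i) ⬝ᵥ
      P.adjMatrix *ᵥ (fun i : Fin (r + 1) => y i) = 2 * ∑ i ∈ Finset.range r, y i * y (i + 1) := by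
    intro y
    rw [dotProduct_adjMatrix_mulVec]
    exact sum_path_weight r (fun i j => y i * y j) (fun i j => mul_comm _ _)
  have nrm : ∀ y : ℕ → ℝ, (fun i : Fin (r + 1) => y i) ⬝ᵥ (fun i : Fin (r + 1) => y i) =
      ∑ i ∈ Finset.range (r + 1), y i ^ 2 := by
    intro y
    rw [← Fin.sum_univ_eq_sum_range (fun i => y i ^ 2)]
    exact Finset.sum_congr rfl fun i _ => (sq _).symm
  -- The constant vector has Rayleigh quotient `2r/(r+1)`.
  have hpos : 0 < μ := by
    have h := P.adjMatrix_isHermitian.dotProduct_mulVec_le ⟨0, hc⟩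
      (fun i : Fin (r + 1) => (fun _ : ℕ => (1 : ℝ)) i) (by intro k hk; simp at hk)
    rw [form fun _ => 1, nrm fun _ => 1] at h
    simp only [one_pow, mul_one, Finset.sum_const, Finset.card_range, nsmul_eq_mul] at h
    have hr' : (1 : ℝ) ≤ r := by exact_mod_cast hr
    by_contra hneg
    push Not at hneg
    have : μ * ((r + 1 : ℕ) : ℝ) ≤ 0 := mul_nonpos_of_nonpos_of_nonneg hneg (by positivity)
    linarith
  obtain ⟨z, hz0, hz⟩ := P.adjMatrix_isHermitian.exists_mulVec_eq_eigenvalues₀ ⟨0, hc⟩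
  set y : ℕ → ℝ := fun i => if h : i < r + 1 then z ⟨i, h⟩ else 0
  have hy : (fun i : Fin (r + 1) => y i) = z := by
    ext i
    simp only [y, dif_pos i.2]
  have hzz : 0 < z ⬝ᵥ z := by
    refine lt_of_le_of_ne (Finset.sum_nonneg fun i _ => mul_self_nonneg _) fun h => hz0 ?_
    exact dotProduct_self_eq_zero.1 h.symm
  have hf : z ⬝ᵥ P.adjMatrix *ᵥ z = μ * (z ⬝ᵥ z) := by
    rw [hz, dotProduct_smul, smul_eq_mul]
  rw [← hy, form, nrm] at hf
  rw [← hy, nrm] at hzz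
  -- Absolute values keep the norm of the eigenvector and do not decrease the form.
  refine ⟨hpos, ?_, fun i => |y i|, fun i => abs_nonneg _, by simpa using hzz, ?_⟩
  · refine le_of_mul_le_mul_right ?_ hzz
    rw [← hf, Finset.mul_sum]
    have h1 := Finset.sum_range_succ (fun i => y i ^ 2) r
    have h2 := Finset.sum_range_succ' (fun i => y i ^ 2) r
    have h3 : ∑ i ∈ Finset.range r, 2 * (y i * y (i + 1)) ≤
        ∑ i ∈ Finset.range r, y i ^ 2 + ∑ i ∈ Finset.range r, y (i + 1) ^ 2 := by
      rw [← Finset.sum_add_distrib]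
      exact Finset.sum_le_sum fun i _ => by nlinarith [sq_nonneg (y i - y (i + 1))]
    nlinarith [sq_nonneg (y r), sq_nonneg (y 0)]
  · simp only [sq_abs]
    rw [← hf]
    refine mul_le_mul_of_nonneg_left (Finset.sum_le_sum fun i _ => ?_) (by norm_num)
    rw [← abs_mul]; exact le_abs_self _

end WeightedGraph

/-! ### The non-backtracking walk and its test vectors. -/

namespace WeightedGraph

open Matrix Finset

variable {V : Type*} [Fintype V] [DecidableEq V]

/-- One step of the non-backtracking random walk on directed edges: from the edge `yu` the walk
moves to the edge `uv`, `v ≠ y`, with probability `weight u v / (w - weight y u)`. -/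
noncomputable def nbStep (G : WeightedGraph V) (w : ℝ) (μ : V → V → ℝ) (u v : V) : ℝ :=
  ∑ y ∈ univ.erase v, μ y u * (G.weight u v / (w - G.weight y u))

/-- The distribution on directed edges of the non-backtracking random walk after `i` steps. -/
noncomputable def nbMass (G : WeightedGraph V) (w : ℝ) (μ : V → V → ℝ) : ℕ → V → V → ℝ
  | 0 => μ
  | i + 1 => G.nbStep w (nbMass G w μ i)

/-- The stationary measure of the non-backtracking random walk. -/
def nbStationary (G : WeightedGraph V) (w : ℝ) (y u : V) : ℝ :=
  G.weight y u * (w - G.weight y u)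

/-- The test vector on the vertices that collects the masses of the first `r + 1` steps, the `i`-th
one with weight `x i ^ 2`. -/
noncomputable def nbVec (G : WeightedGraph V) (w : ℝ) (μ : V → V → ℝ) (x : ℕ → ℝ) (r : ℕ) (u : V) :
    ℝ :=
  Real.sqrt (∑ i ∈ range (r + 1), x i ^ 2 * ∑ y, G.nbMass w μ i y u)

variable {G : WeightedGraph V} {w : ℝ}

theorem nbMass_nonneg (hw : ∀ u v, G.weight u v < w) {μ : V → V → ℝ} (hμ : ∀ y u, 0 ≤ μ y u)
    (i : ℕ) (y u : V) : 0 ≤ G.nbMass w μ i y u := by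
  induction i generalizing y u with
  | zero => exact hμ y u
  | succ i ih =>
    exact sum_nonneg fun z _ => mul_nonneg (ih z y)
      (div_nonneg (G.weight_nonneg y u) (sub_nonneg.2 (hw z y).le))

/-- Linearity in the initial measure lets the stationary walk be split into walks from single
directed edges. -/
theorem nbMass_sum {ι : Type*} (s : Finset ι) (f : ι → V → V → ℝ) (i : ℕ) (y u : V) :
    G.nbMass w (fun y u => ∑ e ∈ s, f e y u) i y u = ∑ e ∈ s, G.nbMass w (f e) i y u := by
  induction i generalizing y u with
  | zero => rfl
  | succ i ih =>
    simp only [nbMass, nbStep, ih, sum_mul]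
    exact sum_comm

/-- The factor `w - weight y u` cancels the denominator of the transition probability, so `yu` sends
`weight u y * weight u v` to `uv`; regularity evaluates the sum over `y ≠ v`. -/
theorem nbMass_nbStationary (hreg : G.IsRegular w) (hw : ∀ u v, G.weight u v < w) (i : ℕ) :
    G.nbMass w (G.nbStationary w) i = G.nbStationary w := by
  induction i with
  | zero => rfl
  | succ i ih =>
    funext u v
    simp only [nbMass, ih, nbStep, nbStationary]
    have h1 : ∀ y ∈ univ.erase v, G.weight y u * (w - G.weight y u) *
        (G.weight u v / (w - G.weight y u)) = G.weight u y * G.weight u v := by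
      intro y _
      have : w - G.weight y u ≠ 0 := (sub_pos.2 (hw y u)).ne'
      rw [G.weight_symm u y]
      field_simp
    have h2 := add_sum_erase univ (fun y => G.weight u y) (mem_univ v)
    have h3 : ∑ y, G.weight u y = w := hreg u
    rw [sum_congr rfl h1, ← sum_mul, show ∑ y ∈ univ.erase v, G.weight u y = w - G.weight u v by
      linarith, mul_comm]

theorem mem_ball_of_nbMass_ne_zero {μ : V → V → ℝ} {v₀ : V} (hμ : ∀ y u, μ y u ≠ 0 → u = v₀)
    (i : ℕ) (y u : V) (h : G.nbMass w μ i y u ≠ 0) : u ∈ G.ball v₀ i := by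
  induction i generalizing y u with
  | zero => rw [hμ y u h]; simp [ball]
  | succ i ih =>
    obtain ⟨z, -, hz⟩ := exists_ne_zero_of_sum_ne_zero h
    have h1 : y ∈ G.ball v₀ i := ih z y (left_ne_zero_of_mul hz)
    have h2 : G.graph.Adj y u := by
      by_contra hn
      exact right_ne_zero_of_mul hz (by rw [G.weight_zero y u hn, zero_div])
    have h3 : G.graph.edist y u ≤ 1 := by
      simpa using SimpleGraph.Walk.edist_le h2.toWalk
    calc G.graph.edist v₀ u ≤ G.graph.edist v₀ y + G.graph.edist y u := SimpleGraph.edist_triangle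
      _ ≤ i + 1 := add_le_add h1 h3
      _ = ((i + 1 : ℕ) : ℕ∞) := by push_cast; rfl

theorem sum_nbMass_succ (μ : V → V → ℝ) (i : ℕ) (u v : V) :
    G.nbMass w μ (i + 1) u v =
      ∑ y ∈ univ.erase v, G.nbMass w μ i y u * (G.weight u v / (w - G.weight y u)) := rfl

/-- Prepares Cauchy–Schwarz: `a` is the mass before a step of probability `p`, and `a * p` the mass
that makes it. -/
theorem mul_mul_sqrt_eq {a p α β : ℝ} (hα : 0 ≤ α) (hβ : 0 ≤ β) (ha : 0 ≤ a) :
    α * β * (a * √p) = √(α ^ 2 * a) * √(β ^ 2 * (a * p)) := by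
  rw [Real.sqrt_mul (sq_nonneg _), Real.sqrt_mul (sq_nonneg _), Real.sqrt_sq hα, Real.sqrt_sq hβ,
    Real.sqrt_mul ha]
  linear_combination -(α * β * √p) * Real.mul_self_sqrt ha

theorem sqrt_mul_sqrt_add_le {a b c d : ℝ} (ha : 0 ≤ a) (hb : 0 ≤ b) (hc : 0 ≤ c) (hd : 0 ≤ d) :
    √a * √b + √c * √d ≤ √(a + c) * √(b + d) := by
  rw [← Real.sqrt_mul (add_nonneg ha hc)]
  refine Real.le_sqrt_of_sq_le ?_
  nlinarith [Real.sq_sqrt ha, Real.sq_sqrt hb, Real.sq_sqrt hc, Real.sq_sqrt hd,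
    sq_nonneg (√a * √d - √c * √b)]

/-- The contribution of the passage from `u` to `v`, summed over the previous vertices. -/
noncomputable def nbFlow (G : WeightedGraph V) (w : ℝ) (μ : V → V → ℝ) (u v : V) : ℝ :=
  ∑ y ∈ univ.erase v, μ y u * √(G.weight u v / (w - G.weight y u))

/-- Cauchy–Schwarz over the pairs of a time `i` and a previous vertex `y ≠ v`. -/
theorem sum_nbFlow_le_sqrt (hw : ∀ u v, G.weight u v < w) {μ : V → V → ℝ} (hμ : ∀ y u, 0 ≤ μ y u)
    {x : ℕ → ℝ} (hx : ∀ i, 0 ≤ x i) (r : ℕ) (u v : V) :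
    ∑ i ∈ range r, x i * x (i + 1) * G.nbFlow w (G.nbMass w μ i) u v ≤
      √(∑ i ∈ range r, x i ^ 2 * ∑ y ∈ univ.erase v, G.nbMass w μ i y u) *
      √(∑ i ∈ range r, x (i + 1) ^ 2 * G.nbMass w μ (i + 1) u v) := by
  have hp : ∀ y, 0 ≤ G.weight u v / (w - G.weight y u) := fun y =>
    div_nonneg (G.weight_nonneg u v) (sub_nonneg.2 (hw y u).le)
  simp only [nbFlow, sum_nbMass_succ, mul_sum]
  simp only [← sum_product']
  refine le_trans (le_of_eq ?_) (Real.sum_sqrt_mul_sqrt_le _ (fun p => ?_) (fun p => ?_))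
  · refine sum_congr rfl fun p _ => ?_
    exact mul_mul_sqrt_eq (hx p.1) (hx (p.1 + 1)) (nbMass_nonneg hw hμ p.1 p.2 u)
  · exact mul_nonneg (sq_nonneg _) (nbMass_nonneg hw hμ p.1 p.2 u)
  · exact mul_nonneg (sq_nonneg _) (mul_nonneg (nbMass_nonneg hw hμ p.1 p.2 u) (hp p.2))

/-- Here non-backtracking is essential. Of the mass at `u`, the part that came from some `y ≠ v`
feeds the flow to `v`, while the part on the edge `vu` is what the flow from `v` delivers. The two
parts are disjoint, so both directions fit into one product. -/
theorem sum_nbFlow_le (hw : ∀ u v, G.weight u v < w) {μ : V → V → ℝ} (hμ : ∀ y u, 0 ≤ μ y u)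
    {x : ℕ → ℝ} (hx : ∀ i, 0 ≤ x i) (r : ℕ) (u v : V) :
    ∑ i ∈ range r, x i * x (i + 1) *
        (G.nbFlow w (G.nbMass w μ i) u v + G.nbFlow w (G.nbMass w μ i) v u) ≤
      G.nbVec w μ x r u * G.nbVec w μ x r v := by
  have hm := nbMass_nonneg (G := G) hw hμ
  have hnn : ∀ a b : V, 0 ≤ ∑ i ∈ range r, x i ^ 2 * ∑ y ∈ univ.erase b, G.nbMass w μ i y a :=
    fun a b => sum_nonneg fun i _ => mul_nonneg (sq_nonneg _) (sum_nonneg fun y _ => hm i y a)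
  have hnn' : ∀ a b : V, 0 ≤ ∑ i ∈ range r, x (i + 1) ^ 2 * G.nbMass w μ (i + 1) a b :=
    fun a b => sum_nonneg fun i _ => mul_nonneg (sq_nonneg _) (hm (i + 1) a b)
  have hle : ∀ a b : V, ∑ i ∈ range r, x i ^ 2 * ∑ y ∈ univ.erase b, G.nbMass w μ i y a +
      ∑ i ∈ range r, x (i + 1) ^ 2 * G.nbMass w μ (i + 1) b a ≤
      ∑ i ∈ range (r + 1), x i ^ 2 * ∑ y, G.nbMass w μ i y a := by
    intro a b
    have h1 : ∀ i, x i ^ 2 * ∑ y, G.nbMass w μ i y a =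
        x i ^ 2 * ∑ y ∈ univ.erase b, G.nbMass w μ i y a + x i ^ 2 * G.nbMass w μ i b a := by
      intro i
      rw [← add_sum_erase univ _ (mem_univ b)]; ring
    rw [sum_congr rfl fun i _ => h1 i, sum_add_distrib, sum_range_succ,
      sum_range_succ' (fun i => x i ^ 2 * G.nbMass w μ i b a)]
    have h2 : 0 ≤ x r ^ 2 * ∑ y ∈ univ.erase b, G.nbMass w μ r y a :=
      mul_nonneg (sq_nonneg _) (sum_nonneg fun y _ => hm r y a)
    have h3 : 0 ≤ x 0 ^ 2 * G.nbMass w μ 0 b a := mul_nonneg (sq_nonneg _) (hm 0 b a)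
    linarith
  simp only [mul_add, sum_add_distrib]
  refine (add_le_add (sum_nbFlow_le_sqrt hw hμ hx r u v)
    ((sum_nbFlow_le_sqrt hw hμ hx r v u).trans_eq (mul_comm _ _))).trans ?_
  refine (sqrt_mul_sqrt_add_le (hnn u v) (hnn' u v) (hnn' v u) (hnn v u)).trans ?_
  refine mul_le_mul (Real.sqrt_le_sqrt (hle u v)) (Real.sqrt_le_sqrt ?_) (Real.sqrt_nonneg _)
    (Real.sqrt_nonneg _)
  rw [add_comm]
  exact hle v u

theorem nbFlow_nbStationary (hw : ∀ u v, G.weight u v < w) (u v : V) :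
    G.nbFlow w (G.nbStationary w) u v =
      ∑ y ∈ univ.erase v, G.weight u y * √(G.weight u v * (w - G.weight u y)) := by
  refine sum_congr rfl fun y _ => ?_
  have h : 0 < w - G.weight u y := sub_pos.2 (hw u y)
  rw [nbStationary, G.weight_symm y u, mul_assoc]
  congr 1
  rw [Real.sqrt_div' _ h.le, Real.sqrt_mul (G.weight_nonneg u v)]
  have h2 : √(w - G.weight u y) ≠ 0 := (Real.sqrt_pos.2 h).ne'
  field_simp
  rw [Real.sq_sqrt h.le, mul_comm]

/-- If the non-backtracking walk has enough flow in the stationary state, some ball of radius `r`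
carries a vector with large Rayleigh quotient. -/
theorem exists_ball_vector (hreg : G.IsRegular w) (hw : ∀ u v, G.weight u v < w)
    {h Λ : ℝ} (hΛ : 0 ≤ Λ) {r : ℕ} {x : ℕ → ℝ} (hx : ∀ i, 0 ≤ x i)
    (hx0 : 0 < ∑ i ∈ range (r + 1), x i ^ 2)
    (hxΛ : Λ * ∑ i ∈ range (r + 1), x i ^ 2 ≤ 2 * ∑ i ∈ range r, x i * x (i + 1))
    (hπ : 0 < ∑ u, ∑ y, G.nbStationary w y u) (hh : 0 ≤ h)
    (hflow : h * ∑ u, ∑ y, G.nbStationary w y u ≤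
      ∑ u, ∑ v, G.weight u v * G.nbFlow w (G.nbStationary w) u v) :
    ∃ (v₀ : V) (g : V → ℝ), g ≠ 0 ∧ (∀ u, g u ≠ 0 → u ∈ G.ball v₀ r) ∧
      h * Λ * (g ⬝ᵥ g) ≤ g ⬝ᵥ G.adjMatrix *ᵥ g := by
  have hπ0 : ∀ y u, 0 ≤ G.nbStationary w y u := fun y u =>
    mul_nonneg (G.weight_nonneg y u) (sub_nonneg.2 (hw y u).le)
  -- `st p` is the stationary measure restricted to the directed edge `p`; the walk from it starts
  -- at the head `p.2`.
  set st : V × V → V → V → ℝ := fun p y u => if p = (y, u) then G.nbStationary w y u else 0 with hst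
  have hst0 : ∀ p y u, 0 ≤ st p y u := by
    intro p y u; simp only [hst]; split_ifs
    exacts [hπ0 y u, le_rfl]
  have hsum : (fun y u => ∑ p, st p y u) = G.nbStationary w := by
    funext y u; simp [hst]
  have hmass : ∀ i y u, ∑ p, G.nbMass w (st p) i y u = G.nbStationary w y u := by
    intro i y u
    rw [← nbMass_sum, hsum, nbMass_nbStationary hreg hw]
  have hnorm : ∀ p, G.nbVec w (st p) x r ⬝ᵥ G.nbVec w (st p) x r =
      ∑ u, ∑ i ∈ range (r + 1), x i ^ 2 * ∑ y, G.nbMass w (st p) i y u := by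
    intro p
    refine sum_congr rfl fun u _ => Real.mul_self_sqrt ?_
    exact sum_nonneg fun i _ => mul_nonneg (sq_nonneg _)
      (sum_nonneg fun y _ => nbMass_nonneg hw (hst0 p) i y u)
  have hN : ∑ p, G.nbVec w (st p) x r ⬝ᵥ G.nbVec w (st p) x r =
      (∑ i ∈ range (r + 1), x i ^ 2) * ∑ u, ∑ y, G.nbStationary w y u := by
    simp only [hnorm]
    rw [sum_comm, mul_sum]
    refine sum_congr rfl fun u _ => ?_
    rw [sum_comm, sum_mul]
    refine sum_congr rfl fun i _ => ?_
    rw [← mul_sum, sum_comm]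
    simp only [hmass]
  have hflowp : ∀ i u v, ∑ p, G.nbFlow w (G.nbMass w (st p) i) u v =
      G.nbFlow w (G.nbStationary w) u v := by
    intro i u v
    simp only [nbFlow]
    rw [sum_comm]
    refine sum_congr rfl fun y _ => ?_
    rw [← sum_mul, hmass]
  have hF : (2 * ∑ i ∈ range r, x i * x (i + 1)) *
      ∑ u, ∑ v, G.weight u v * G.nbFlow w (G.nbStationary w) u v ≤
      ∑ p, G.nbVec w (st p) x r ⬝ᵥ G.adjMatrix *ᵥ G.nbVec w (st p) x r := by
    calc _ = ∑ p, ∑ u, ∑ v, G.weight u v * ∑ i ∈ range r, x i * x (i + 1) *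
          (G.nbFlow w (G.nbMass w (st p) i) u v + G.nbFlow w (G.nbMass w (st p) i) v u) := by
          rw [sum_comm (s := (univ : Finset (V × V)))]
          have h1 : ∀ u, ∑ p, ∑ v, G.weight u v * ∑ i ∈ range r, x i * x (i + 1) *
              (G.nbFlow w (G.nbMass w (st p) i) u v + G.nbFlow w (G.nbMass w (st p) i) v u) =
              ∑ v, (∑ i ∈ range r, x i * x (i + 1)) *
                (G.weight u v * G.nbFlow w (G.nbStationary w) u v +
                G.weight v u * G.nbFlow w (G.nbStationary w) v u) := by
            intro u
            rw [sum_comm]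
            refine sum_congr rfl fun v _ => ?_
            rw [← mul_sum, sum_comm, sum_mul, mul_sum]
            refine sum_congr rfl fun i _ => ?_
            rw [← mul_sum, sum_add_distrib, hflowp, hflowp, G.weight_symm v u]
            ring
          rw [sum_congr rfl fun u _ => h1 u]
          simp only [← mul_sum, sum_add_distrib]
          rw [sum_comm (f := fun u v => G.weight v u * G.nbFlow w (G.nbStationary w) v u)]
          ring
      _ ≤ _ := by
          refine sum_le_sum fun p _ => ?_
          rw [dotProduct_adjMatrix_mulVec]
          exact sum_le_sum fun u _ => sum_le_sum fun v _ => mul_le_mul_of_nonneg_left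
            (sum_nbFlow_le hw (hst0 p) hx r u v) (G.weight_nonneg u v)
  by_contra hcon
  push Not at hcon
  have hlt : ∀ p : V × V, G.nbVec w (st p) x r ≠ 0 →
      G.nbVec w (st p) x r ⬝ᵥ G.adjMatrix *ᵥ G.nbVec w (st p) x r <
        h * Λ * (G.nbVec w (st p) x r ⬝ᵥ G.nbVec w (st p) x r) := by
    intro p hp
    refine hcon p.2 _ hp fun u hu => ?_
    have h1 : ∑ i ∈ range (r + 1), x i ^ 2 * ∑ y, G.nbMass w (st p) i y u ≠ 0 := by
      intro h0; apply hu; rw [nbVec, h0, Real.sqrt_zero]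
    obtain ⟨i, hi, h2⟩ := exists_ne_zero_of_sum_ne_zero h1
    obtain ⟨y, -, h3⟩ := exists_ne_zero_of_sum_ne_zero (right_ne_zero_of_mul h2)
    have h4 : u ∈ G.ball p.2 i := by
      refine mem_ball_of_nbMass_ne_zero (w := w) (fun y u h5 => ?_) i y u h3
      by_contra h6
      refine h5 (if_neg fun h7 => h6 ?_)
      rw [h7]
    exact le_trans (Set.mem_ofPred.1 h4)
      (Nat.cast_le.2 (Nat.lt_succ_iff.1 (mem_range.1 hi)))
  -- A vanishing test vector gives equality, so strictness of the sum needs one that does not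
  -- vanish.
  obtain ⟨p₀, hp₀⟩ : ∃ p, G.nbVec w (st p) x r ≠ 0 := by
    by_contra hall
    push Not at hall
    have : ∑ p, G.nbVec w (st p) x r ⬝ᵥ G.nbVec w (st p) x r = 0 :=
      sum_eq_zero fun p _ => by rw [hall p, dotProduct_zero]
    rw [hN] at this
    exact (mul_pos hx0 hπ).ne' this
  have hfin : ∑ p, G.nbVec w (st p) x r ⬝ᵥ G.adjMatrix *ᵥ G.nbVec w (st p) x r <
      ∑ p, h * Λ * (G.nbVec w (st p) x r ⬝ᵥ G.nbVec w (st p) x r) := by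
    refine sum_lt_sum (fun p _ => ?_) ⟨p₀, mem_univ _, hlt p₀ hp₀⟩
    by_cases hp : G.nbVec w (st p) x r = 0
    · simp [hp]
    · exact (hlt p hp).le
  rw [← mul_sum, hN] at hfin
  have h1 := mul_le_mul hxΛ hflow (mul_nonneg hh hπ.le) ((mul_nonneg hΛ hx0.le).trans hxΛ)
  have h2 : Λ * (∑ i ∈ range (r + 1), x i ^ 2) * (h * ∑ u, ∑ y, G.nbStationary w y u) =
    h * Λ * ((∑ i ∈ range (r + 1), x i ^ 2) * ∑ u, ∑ y, G.nbStationary w y u) := by ring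
  linarith

end WeightedGraph

/-! ### The local flow inequality at a vertex. -/

section LocalInequality

open Finset

/-- With `s = √u` the gap is `s (s - 1)² (s + 2) / 2`. -/
theorem half_mul_three_sub_le_sqrt {u : ℝ} (hu : 0 ≤ u) : u * (3 - u) / 2 ≤ √u := by
  have h := Real.sq_sqrt hu
  have hs := Real.sqrt_nonneg u
  set s := √u
  rw [← h]
  nlinarith [mul_nonneg hs (mul_nonneg (sq_nonneg (s - 1)) (by linarith : 0 ≤ s + 2))]

/-- With `s = √t` the gap is `(s - 1)² (s + 1/2 - q⁻¹ (s + 1)²)`. The quadratic term beyond the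
tangent line is the gain that later pays for all errors. -/
theorem quadratic_le_mul_sqrt {t q : ℝ} (hq : 6 ≤ q) (ht : 0 ≤ t) (htq : t ≤ 2 * q) :
    3 / 2 * t - 1 / 2 + q⁻¹ * (t - 1) ^ 2 ≤ t * √t := by
  have h := Real.sq_sqrt ht
  have hs := Real.sqrt_nonneg t
  set s := √t
  have hsq : s + 2 ≤ q := by
    rcases le_total s 4 with h4 | h4
    · linarith
    · nlinarith
  have h1 : (s + 1) ^ 2 ≤ q * (s + 1 / 2) := by nlinarith
  have h2 : q⁻¹ * (s + 1) ^ 2 ≤ s + 1 / 2 := by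
    rw [inv_mul_le_iff₀ (by linarith)]; exact h1
  have h3 := mul_le_mul_of_nonneg_left h2 (sq_nonneg (s - 1))
  rw [← h]
  nlinarith

/-- Cubic upper bound for the diagonal terms, with `c = 1 / √(d - 1)` and `x = t - 1`. -/
theorem diagonal_term_le {c x : ℝ} (hc : 0 < c) (hc6 : c ≤ 1 / 6) (hx : -1 ≤ x) (hxc : c * x ≤ 2) :
    (1 + x) * (1 - c ^ 2 * x / 2 - c ^ 4 * x ^ 2 / 2) * (1 + 3 / 2 * x + c * x ^ 2) ≤
      1 + (5 / 2 - c ^ 2 / 2) * x + (c + 7 / 2) * x ^ 2 := by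
  -- `-κ` is the coefficient of `x ^ 3` in right side minus left side; the lower-order remainder is
  -- at least `2 x ^ 2`, so `κ * x ≤ 2` suffices.
  set κ := c * (1 - c ^ 2 / 2) - 3 / 4 * (c ^ 2 + c ^ 4) - c ^ 4 / 2 with hκ
  have h2 : c ^ 2 ≤ c / 6 := by nlinarith
  have h4 : c ^ 4 ≤ c ^ 2 / 36 := by nlinarith [sq_nonneg c]
  have h3 : c ^ 3 ≤ c ^ 2 / 6 := by nlinarith [sq_nonneg c]
  have hκ0 : 0 ≤ κ := by rw [hκ]; nlinarith
  have hκc : κ ≤ c := by rw [hκ]; nlinarith [pow_pos hc 3, pow_pos hc 2, pow_pos hc 4]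
  have hκx : κ * x ≤ 2 := by
    rcases le_total x 0 with h | h
    · nlinarith
    · nlinarith
  have h5 : 0 ≤ x ^ 2 * (c ^ 3 / 2 + c ^ 5 / 2 * (1 + x) + 3 / 4 * c ^ 4) := by
    have : 0 ≤ 1 + x := by linarith
    positivity
  have h6 : 0 ≤ x ^ 2 * (2 + 5 / 4 * c ^ 2 + c ^ 4 / 2 - κ * x +
      x ^ 2 * (c ^ 3 / 2 + c ^ 5 / 2 * (1 + x) + 3 / 4 * c ^ 4)) := by
    refine mul_nonneg (sq_nonneg _) ?_
    have := pow_pos hc 4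
    have := pow_pos hc 2
    linarith
  have h7 : 1 + (5 / 2 - c ^ 2 / 2) * x + (c + 7 / 2) * x ^ 2 -
      (1 + x) * (1 - c ^ 2 * x / 2 - c ^ 4 * x ^ 2 / 2) * (1 + 3 / 2 * x + c * x ^ 2) =
      x ^ 2 * (2 + 5 / 4 * c ^ 2 + c ^ 4 / 2 - κ * x +
      x ^ 2 * (c ^ 3 / 2 + c ^ 5 / 2 * (1 + x) + 3 / 4 * c ^ 4)) := by
    rw [hκ]; ring
  linarith

/-- The power sums `D`, `P`, `C` of the deviations satisfy the inequality to which the local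
estimate reduces. -/
theorem power_sum_inequality {q c d D P C : ℝ} (hq : 6 ≤ q) (hqc : q * c = 1) (hd : d = 1 + q ^ 2)
    (hP : 0 ≤ P) (hDd : D ≤ d) (hD : -(2 * d + 5) ≤ D) (hDP : D ^ 2 + D * P ≤ d * P)
    (hC : -P ≤ C) (hC' : C ≤ 2 * q * P) (hPq : P ≤ 5 * q ^ 2 + 6) :
    d ^ 2 - (d + D + P) + (d - 2) / 2 * D ≤
      (d - c ^ 2 * D / 2 - (c ^ 2 + c ^ 4) / 2 * P - c ^ 4 / 2 * C) * (d + D / 2 + c * P) -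
      ((d - D) + (5 / 2 - c ^ 2 / 2) * D + (c + 7 / 2) * P) := by
  have hc : 0 < c := by
    by_contra h
    push Not at h
    nlinarith
  have hc6 : c ≤ 1 / 6 := by nlinarith
  have hdc : d * c ^ 2 = 1 + c ^ 2 := by
    rw [hd]; linear_combination (q * c + 1) * hqc
  have hc2 : c ^ 2 ≤ 1 / 36 := by nlinarith
  have hc20 : 0 < c ^ 2 := by positivity
  have hd0 : 0 < d := by nlinarith
  have hc3 : c * (1 + c ^ 2) ≤ 1 / 6 * (1 + 1 / 36) := by gcongr
  have hc4 : c ^ 2 * (1 + c ^ 2) ≤ 1 / 36 * (1 + 1 / 36) := by gcongr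
  -- Budget: the gain is `d c P = (q + c) P` with `q ≥ 6`. The errors `T2` to `T9` cost at most
  -- `1.77 P` in all, and `(c + 5/2) P` remains to be subtracted.
  have T2 : d * ((c ^ 2 + c ^ 4) / 2) * P ≤ 0.53 * P := by
    refine mul_le_mul_of_nonneg_right ?_ hP
    have : d * ((c ^ 2 + c ^ 4) / 2) = (1 + c ^ 2) ^ 2 / 2 := by
      linear_combination (1 + c ^ 2) / 2 * hdc
    have h1 : (1 + c ^ 2) ^ 2 ≤ (1 + 1 / 36) ^ 2 := by gcongr
    rw [this]; linarith
  have T3 : d * (c ^ 4 / 2) * C ≤ 0.18 * P := by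
    have h1 : d * (c ^ 4 / 2) * C ≤ d * (c ^ 4 / 2) * (2 * q * P) :=
      mul_le_mul_of_nonneg_left hC' (by positivity)
    have h2 : d * (c ^ 4 / 2) * (2 * q * P) = c * (1 + c ^ 2) * P := by
      linear_combination c ^ 2 * q * P * hdc + (1 + c ^ 2) * c * P * hqc
    have h3 : c * (1 + c ^ 2) ≤ 0.18 := by linarith
    linarith [mul_le_mul_of_nonneg_right h3 hP]
  have T4 : c ^ 2 / 4 * (D ^ 2 + D * P) ≤ 0.26 * P := by
    have h1 : c ^ 2 / 4 * (D ^ 2 + D * P) ≤ c ^ 2 / 4 * (d * P) :=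
      mul_le_mul_of_nonneg_left hDP (by positivity)
    have h2 : c ^ 2 / 4 * (d * P) = (1 + c ^ 2) / 4 * P := by
      linear_combination P / 4 * hdc
    have h3 : (1 + c ^ 2) / 4 ≤ 0.26 := by linarith
    linarith [mul_le_mul_of_nonneg_right h3 hP]
  have hDP' : D * P ≤ d * P := mul_le_mul_of_nonneg_right hDd hP
  have T5 : c ^ 4 / 4 * (D * P) ≤ 0.01 * P := by
    have h1 : c ^ 4 / 4 * (D * P) ≤ c ^ 4 / 4 * (d * P) :=
      mul_le_mul_of_nonneg_left hDP' (by positivity)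
    have h2 : c ^ 4 / 4 * (d * P) = c ^ 2 * (1 + c ^ 2) / 4 * P := by
      linear_combination c ^ 2 * P / 4 * hdc
    have h3 : c ^ 2 * (1 + c ^ 2) / 4 ≤ 0.01 := by linarith
    linarith [mul_le_mul_of_nonneg_right h3 hP]
  have hDC : D * C ≤ 2 * q * d * P := by
    rcases le_total 0 D with h | h
    · have h1 := mul_le_mul_of_nonneg_left hC' h
      have h2 := mul_le_mul_of_nonneg_left hDP' (by linarith : 0 ≤ 2 * q)
      linarith
    · have h1 : D * C ≤ (-D) * P := by nlinarith
      have h2 : (-D) * P ≤ (2 * d + 5) * P := mul_le_mul_of_nonneg_right (by linarith) hP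
      have h3 : (2 * d + 5) * P ≤ (2 * q * d) * P := mul_le_mul_of_nonneg_right (by nlinarith) hP
      linarith
  have T6 : c ^ 4 / 4 * (D * C) ≤ 0.09 * P := by
    have h1 : c ^ 4 / 4 * (D * C) ≤ c ^ 4 / 4 * (2 * q * d * P) :=
      mul_le_mul_of_nonneg_left hDC (by positivity)
    have h2 : c ^ 4 / 4 * (2 * q * d * P) = c * (1 + c ^ 2) / 2 * P := by
      linear_combination c ^ 2 * q * P / 2 * hdc + (1 + c ^ 2) * c * P / 2 * hqc
    have h3 : c * (1 + c ^ 2) / 2 ≤ 0.09 := by linarith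
    linarith [mul_le_mul_of_nonneg_right h3 hP]
  have T7 : c ^ 3 / 2 * (D * P) ≤ 0.09 * P := by
    have h1 : c ^ 3 / 2 * (D * P) ≤ c ^ 3 / 2 * (d * P) :=
      mul_le_mul_of_nonneg_left hDP' (by positivity)
    have h2 : c ^ 3 / 2 * (d * P) = c * (1 + c ^ 2) / 2 * P := by
      linear_combination c * P / 2 * hdc
    have h3 : c * (1 + c ^ 2) / 2 ≤ 0.09 := by linarith
    linarith [mul_le_mul_of_nonneg_right h3 hP]
  have hPc : c ^ 2 * P ≤ 5.17 := by
    have h1 := mul_le_mul_of_nonneg_left hPq hc20.le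
    have h2 : c ^ 2 * (5 * q ^ 2 + 6) = 5 + 6 * c ^ 2 := by
      linear_combination 5 * (q * c + 1) * hqc
    linarith
  have T8 : c * (c ^ 2 + c ^ 4) / 2 * P * P ≤ 0.46 * P := by
    refine mul_le_mul_of_nonneg_right ?_ hP
    have h1 : c * (c ^ 2 + c ^ 4) / 2 * P = c * (1 + c ^ 2) / 2 * (c ^ 2 * P) := by ring
    have h3 : c * (1 + c ^ 2) / 2 ≤ 37 / 432 := by linarith
    rw [h1]
    calc c * (1 + c ^ 2) / 2 * (c ^ 2 * P) ≤ 37 / 432 * 5.17 := by gcongr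
      _ ≤ 0.46 := by norm_num
  have T9 : c ^ 5 / 2 * C * P ≤ 0.15 * P := by
    refine mul_le_mul_of_nonneg_right ?_ hP
    have h1 : c ^ 5 / 2 * C ≤ c ^ 5 / 2 * (2 * q * P) :=
      mul_le_mul_of_nonneg_left hC' (by positivity)
    have h2 : c ^ 5 / 2 * (2 * q * P) = c ^ 2 * (c ^ 2 * P) := by
      linear_combination c ^ 4 * P * hqc
    have h3 : c ^ 2 * (c ^ 2 * P) ≤ 1 / 36 * 5.17 := by gcongr
    linarith
  have T1 : d * c * P = (q + c) * P := by
    have : d * c = q + c := by rw [hd]; linear_combination q * hqc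
    rw [this]
  have T0 : 6 * P ≤ q * P := mul_le_mul_of_nonneg_right hq hP
  have key : (d - c ^ 2 * D / 2 - (c ^ 2 + c ^ 4) / 2 * P - c ^ 4 / 2 * C) * (d + D / 2 + c * P) -
      ((d - D) + (5 / 2 - c ^ 2 / 2) * D + (c + 7 / 2) * P) -
      (d ^ 2 - (d + D + P) + (d - 2) / 2 * D) =
      d * c * P - d * ((c ^ 2 + c ^ 4) / 2) * P - d * (c ^ 4 / 2) * C -
      c ^ 2 / 4 * (D ^ 2 + D * P) - c ^ 4 / 4 * (D * P) - c ^ 4 / 4 * (D * C) -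
      c ^ 3 / 2 * (D * P) - c * (c ^ 2 + c ^ 4) / 2 * P * P - c ^ 5 / 2 * C * P -
      (c + 5 / 2) * P := by
    linear_combination -(D / 2) * hdc
  linarith

/-- The local estimate at a vertex: `t` lists the weights of the incident edges, normalised to have
sum `d`. -/
theorem local_flow_inequality {ι : Type*} [DecidableEq ι] (s : Finset ι) (t : ι → ℝ) {d : ℝ}
    (hd : 39 ≤ d) (ht : ∀ i ∈ s, 0 ≤ t i) (hsum : ∑ i ∈ s, t i = d)
    (hsq : ∑ i ∈ s, t i ^ 2 ≤ 4 * (d - 1)) :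
    d ^ 2 - ∑ i ∈ s, t i ^ 2 + (d - 2) / 2 * (d - s.card) ≤
      ∑ j ∈ s, ∑ i ∈ s.erase j, t j * t i * √(t j * ((d - t i) / (d - 1))) := by
  have hQ0 : 0 ≤ ∑ i ∈ s, t i ^ 2 := sum_nonneg fun i _ => sq_nonneg _
  -- For so many edges the left side is not positive. Otherwise `D = d - s.card` is at least `-(2d +
  -- 5)`.
  rcases le_total (3 * d + 5) (s.card : ℝ) with hk | hk
  · refine le_trans ?_ (sum_nonneg fun j hj => sum_nonneg fun i hi =>
      mul_nonneg (mul_nonneg (ht j hj) (ht i (mem_of_mem_erase hi))) (Real.sqrt_nonneg _))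
    nlinarith
  set q := √(d - 1) with hq
  have hqq : q ^ 2 = d - 1 := Real.sq_sqrt (by linarith)
  have hq6 : 6 ≤ q := Real.le_sqrt_of_sq_le (by linarith)
  have hdq : d = 1 + q ^ 2 := by linarith
  have hq0 : 0 < q := by linarith
  set c := q⁻¹ with hc
  have hqc : q * c = 1 := mul_inv_cancel₀ hq0.ne'
  have hc0 : 0 < c := inv_pos.2 hq0
  have hc6 : c ≤ 1 / 6 := by nlinarith
  have hdc : (d - 1) * c ^ 2 = 1 := by rw [← hqq]; linear_combination (q * c + 1) * hqc
  have htq : ∀ i ∈ s, t i ≤ 2 * q := by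
    intro i hi
    have h1 : t i ^ 2 ≤ ∑ i ∈ s, t i ^ 2 :=
      single_le_sum (f := fun i => t i ^ 2) (fun i _ => sq_nonneg _) hi
    refine abs_le_of_sq_le_sq' ?_ (by linarith) |>.2
    nlinarith
  have htd : ∀ i ∈ s, t i ≤ d := fun i hi => (htq i hi).trans (by nlinarith)
  set x : ι → ℝ := fun i => t i - 1 with hx
  set ℓ : ι → ℝ := fun i => 1 - c ^ 2 * x i / 2 - c ^ 4 * x i ^ 2 / 2 with hℓ
  set m : ι → ℝ := fun i => 1 + 3 / 2 * x i + c * x i ^ 2 with hm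
  have hu : ∀ i, (d - t i) / (d - 1) = 1 - c ^ 2 * x i := by
    intro i
    rw [div_eq_iff (by linarith)]
    simp only [hx]
    linear_combination (t i - 1) * hdc
  have hu0 : ∀ i ∈ s, 0 ≤ (d - t i) / (d - 1) := fun i hi =>
    div_nonneg (by linarith [htd i hi]) (by linarith)
  have hℓu : ∀ i, ℓ i = (d - t i) / (d - 1) * (3 - (d - t i) / (d - 1)) / 2 := by
    intro i; rw [hu]; simp only [hℓ]; ring
  have hℓle : ∀ i ∈ s, ℓ i ≤ √((d - t i) / (d - 1)) := fun i hi => by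
    rw [hℓu]; exact half_mul_three_sub_le_sqrt (hu0 i hi)
  have hℓ0 : ∀ i ∈ s, 0 ≤ ℓ i := by
    intro i hi
    rw [hℓu]
    have : (d - t i) / (d - 1) ≤ 3 := by
      rw [div_le_iff₀ (by linarith)]; linarith [ht i hi]
    have := hu0 i hi
    exact div_nonneg (mul_nonneg this (by linarith)) (by norm_num)
  have hmle : ∀ j ∈ s, m j ≤ t j * √(t j) := fun j hj => by
    refine le_trans (le_of_eq ?_) (quadratic_le_mul_sqrt hq6 (ht j hj) (htq j hj))
    simp only [hm, hx, hc]; ring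
  have hbound : (∑ i ∈ s, t i * ℓ i) * (∑ j ∈ s, m j) - ∑ j ∈ s, t j * ℓ j * m j ≤
      ∑ j ∈ s, ∑ i ∈ s.erase j, t j * t i * √(t j * ((d - t i) / (d - 1))) := by
    have h1 : (∑ i ∈ s, t i * ℓ i) * (∑ j ∈ s, m j) - ∑ j ∈ s, t j * ℓ j * m j =
        ∑ j ∈ s, ∑ i ∈ s.erase j, m j * (t i * ℓ i) := by
      rw [mul_comm, sum_mul, ← sum_sub_distrib]
      refine sum_congr rfl fun j hj => ?_
      rw [← mul_sum, ← add_sum_erase s _ hj]; ring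
    rw [h1]
    refine sum_le_sum fun j hj => sum_le_sum fun i hi => ?_
    have hi' := mem_of_mem_erase hi
    -- `m j` may be negative, so it is replaced first, while its cofactor is known to be
    -- nonnegative.
    calc m j * (t i * ℓ i) ≤ (t j * √(t j)) * (t i * ℓ i) :=
          mul_le_mul_of_nonneg_right (hmle j hj) (mul_nonneg (ht i hi') (hℓ0 i hi'))
      _ ≤ (t j * √(t j)) * (t i * √((d - t i) / (d - 1))) :=
          mul_le_mul_of_nonneg_left (mul_le_mul_of_nonneg_left (hℓle i hi') (ht i hi'))
            (mul_nonneg (ht j hj) (Real.sqrt_nonneg _))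
      _ = _ := by rw [Real.sqrt_mul (ht j hj)]; ring
  refine le_trans ?_ hbound
  set D := ∑ i ∈ s, x i with hD
  set P := ∑ i ∈ s, x i ^ 2 with hP
  set C := ∑ i ∈ s, x i ^ 3 with hC
  have hDk : D = d - s.card := by
    simp only [hD, hx, sum_sub_distrib, hsum, sum_const, nsmul_eq_mul, mul_one]
  have hQ : ∑ i ∈ s, t i ^ 2 = d + D + P := by
    rw [hD, hP, ← hsum, ← sum_add_distrib, ← sum_add_distrib]
    refine sum_congr rfl fun i _ => ?_
    simp only [hx]; ring
  have hA : ∑ i ∈ s, t i * ℓ i =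
      d - c ^ 2 * D / 2 - (c ^ 2 + c ^ 4) / 2 * P - c ^ 4 / 2 * C := by
    rw [hD, hP, hC, ← hsum, mul_div_right_comm, mul_sum, mul_sum, mul_sum, ← sum_sub_distrib,
      ← sum_sub_distrib, ← sum_sub_distrib]
    refine sum_congr rfl fun i _ => ?_
    simp only [hℓ, hx]; ring
  have hB : ∑ j ∈ s, m j = d + D / 2 + c * P := by
    rw [hD, hP, ← hsum, div_eq_mul_inv, sum_mul, mul_sum, ← sum_add_distrib, ← sum_add_distrib]
    refine sum_congr rfl fun i _ => ?_
    simp only [hm, hx]; ring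
  have hT : ∑ j ∈ s, t j * ℓ j * m j ≤
      (d - D) + (5 / 2 - c ^ 2 / 2) * D + (c + 7 / 2) * P := by
    have h1 : (d - D) + (5 / 2 - c ^ 2 / 2) * D + (c + 7 / 2) * P =
        ∑ j ∈ s, (1 + (5 / 2 - c ^ 2 / 2) * x j + (c + 7 / 2) * x j ^ 2) := by
      simp only [sum_add_distrib, ← mul_sum, sum_const, nsmul_eq_mul, mul_one]
      rw [← hD, ← hP, hDk]; ring
    rw [h1]
    refine sum_le_sum fun j hj => ?_
    have h2 := diagonal_term_le (c := c) (x := x j) hc0 hc6 (by simp only [hx]; linarith [ht j hj])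
      (by simp only [hx]; nlinarith [htq j hj])
    refine le_trans (le_of_eq ?_) h2
    simp only [hm, hℓ, hx]; ring
  have hP0 : 0 ≤ P := sum_nonneg fun i _ => sq_nonneg _
  have hk0 : (0 : ℝ) ≤ s.card := Nat.cast_nonneg _
  have hCS : D ^ 2 ≤ s.card * P := sq_sum_le_card_mul_sum_sq
  have hC1 : -P ≤ C := by
    rw [hP, hC, ← sum_neg_distrib]
    refine sum_le_sum fun i hi => ?_
    have : 0 ≤ t i * x i ^ 2 := mul_nonneg (ht i hi) (sq_nonneg _)
    simp only [hx] at this ⊢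
    linarith
  have hC2 : C ≤ 2 * q * P := by
    rw [hP, hC, mul_sum]
    refine sum_le_sum fun i hi => ?_
    have h1 : x i ≤ 2 * q := by simp only [hx]; linarith [htq i hi]
    have := mul_le_mul_of_nonneg_right h1 (sq_nonneg (x i))
    linarith
  have hk' : (s.card : ℝ) = d - D := by linarith
  rw [hk'] at hCS hk hk0
  -- The bound on `P` comes from `P = ∑ t² - d - D ≤ 4q² - d + (2d + 5) = 5q² + 6`.
  have hmain := power_sum_inequality (D := D) hq6 hqc hdq hP0 (by linarith) (by linarith)
    (by linarith) hC1 hC2 (by rw [hQ] at hsq; linarith)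
  rw [hQ, hA, hB, ← hDk]
  linarith

end LocalInequality

/-! ### Heavy stars, the global flow bound and the vector on a ball. -/

namespace WeightedGraph

open Matrix Finset

variable {V : Type*} {G : WeightedGraph V}

theorem ball_mono {v : V} {r s : ℕ} (h : r ≤ s) : G.ball v r ⊆ G.ball v s := fun _ hu =>
  le_trans (Set.mem_ofPred.1 hu) (Nat.cast_le.2 h)

theorem adj_of_weight_ne_zero {u v : V} (h : G.weight u v ≠ 0) : G.graph.Adj u v := by
  by_contra hn
  exact h (G.weight_zero u v hn)

theorem mem_ball_succ {v u b : V} {r : ℕ} (hu : u ∈ G.ball v r) (h : G.weight u b ≠ 0) :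
    b ∈ G.ball v (r + 1) := by
  have h3 : G.graph.edist u b ≤ 1 := by
    simpa using SimpleGraph.Walk.edist_le (adj_of_weight_ne_zero h).toWalk
  calc G.graph.edist v b ≤ G.graph.edist v u + G.graph.edist u b := SimpleGraph.edist_triangle
    _ ≤ r + 1 := add_le_add hu h3
    _ = ((r + 1 : ℕ) : ℕ∞) := by push_cast; rfl

theorem mem_ball_self (v : V) (r : ℕ) : v ∈ G.ball v r := by simp [ball]

open Classical in
theorem sum_card_neighbors [Fintype V] [Nonempty V] :
    ∑ u, ((univ.filter fun v => G.graph.Adj u v).card : ℝ) = G.avgDegree * Fintype.card V := by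
  have h1 := G.graph.sum_degrees_eq_twice_card_edges
  have h2 : G.graph.edgeSet.ncard = G.graph.edgeFinset.card := by
    rw [← SimpleGraph.coe_edgeFinset, Set.ncard_coe_finset]
  have h3 : (Fintype.card V : ℝ) ≠ 0 := by positivity
  rw [avgDegree, div_mul_cancel₀ _ h3, h2]
  have h4 : ∀ u, (univ.filter fun v => G.graph.Adj u v).card = G.graph.degree u := by
    intro u
    rw [← SimpleGraph.card_neighborFinset_eq_degree, SimpleGraph.neighborFinset_eq_filter]
  simp only [h4]
  exact_mod_cast h1

variable [Fintype V] [DecidableEq V]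

/-- The star around a vertex has Rayleigh quotient at least the Euclidean norm of its weights. -/
theorem exists_star_vector {θ : ℝ} (v : V) (hv : 0 < ∑ u, G.weight v u ^ 2)
    (hθ : θ ≤ √(∑ u, G.weight v u ^ 2)) {r : ℕ} (hr : 1 ≤ r) :
    ∃ g : V → ℝ, g ≠ 0 ∧ (∀ u, g u ≠ 0 → u ∈ G.ball v r) ∧
      θ * (g ⬝ᵥ g) ≤ g ⬝ᵥ G.adjMatrix *ᵥ g := by
  set T := ∑ u, G.weight v u ^ 2 with hT
  have hτ : 0 < √T := Real.sqrt_pos.2 hv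
  have hτ2 : √T ^ 2 = T := Real.sq_sqrt hv.le
  have hvv : G.weight v v = 0 := G.weight_zero v v (G.graph.loopless.irrefl v)
  have hnorm : (fun u => (if u = v then √T else 0) + G.weight v u) ⬝ᵥ
      (fun u => (if u = v then √T else 0) + G.weight v u) = 2 * T := by
    have h1 : ∀ u, ((if u = v then √T else 0) + G.weight v u) *
        ((if u = v then √T else 0) + G.weight v u) =
        (if u = v then T else 0) + G.weight v u ^ 2 := by
      intro u
      split_ifs with h
      · rw [h, hvv]; nlinarith
      · ring
    simp only [dotProduct, h1, sum_add_distrib, sum_ite_eq', mem_univ, if_true]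
    rw [← hT]; ring
  have hform : 2 * √T * T ≤ (fun u => (if u = v then √T else 0) + G.weight v u) ⬝ᵥ
      G.adjMatrix *ᵥ (fun u => (if u = v then √T else 0) + G.weight v u) := by
    rw [dotProduct_adjMatrix_mulVec]
    -- Only the edges at `v` are kept; edges between its neighbours contribute nonnegatively.
    have h1 : ∀ a b, (if a = v then √T * (G.weight a b * G.weight v b) else 0) +
        (if b = v then √T * (G.weight a b * G.weight v a) else 0) ≤
        G.weight a b * (((if a = v then √T else 0) + G.weight v a) *
          ((if b = v then √T else 0) + G.weight v b)) := by
      intro a b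
      have h2 : 0 ≤ G.weight a b * (G.weight v a * G.weight v b) :=
        mul_nonneg (G.weight_nonneg _ _) (mul_nonneg (G.weight_nonneg _ _) (G.weight_nonneg _ _))
      have h3 : 0 ≤ G.weight a b * (√T * √T) :=
        mul_nonneg (G.weight_nonneg _ _) (mul_nonneg hτ.le hτ.le)
      split_ifs <;> linarith
    refine le_trans (le_of_eq ?_) (sum_le_sum fun a _ => sum_le_sum fun b _ => h1 a b)
    simp only [sum_add_distrib]
    rw [sum_comm (f := fun a b => if a = v then √T * (G.weight a b * G.weight v b) else 0)]
    simp only [sum_ite_eq', mem_univ, if_true, ← mul_sum]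
    have h4 : ∑ u, G.weight u v * G.weight v u = T :=
      sum_congr rfl fun u _ => by rw [G.weight_symm u v]; ring
    have h5 : ∑ u, G.weight v u * G.weight v u = T := sum_congr rfl fun u _ => (sq _).symm
    rw [h4, h5]; ring
  refine ⟨fun u => (if u = v then √T else 0) + G.weight v u, ?_, ?_, ?_⟩
  · intro h
    rw [h, dotProduct_zero] at hnorm
    linarith
  · intro u hu
    by_cases huv : u = v
    · rw [huv]; exact mem_ball_self v r
    · refine ball_mono hr (mem_ball_succ (mem_ball_self v 0) (b := u) fun h => hu ?_)
      simp [huv, h]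
  · rw [hnorm]
    refine le_trans ?_ hform
    nlinarith

/-- The flow condition for the stationary non-backtracking walk, when no star is heavy. -/
theorem flow_inequality [Nonempty V] {w d : ℝ} (hw0 : 0 < w) (hreg : G.IsRegular w)
    (hw : ∀ u v, G.weight u v < w) (hdeg : G.avgDegree = d) (hd : 39 ≤ d)
    (hstar : ∀ u, ∑ v, G.weight u v ^ 2 ≤ (2 * (w * √(d - 1) / d)) ^ 2) :
    w * √(d - 1) / d * ∑ u, ∑ y, G.nbStationary w y u ≤
      ∑ u, ∑ v, G.weight u v * G.nbFlow w (G.nbStationary w) u v := by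
  classical
  set q := √(d - 1) with hq
  have hqq : q ^ 2 = d - 1 := Real.sq_sqrt (by linarith)
  have hq0 : 0 < q := Real.sqrt_pos.2 (by linarith)
  have hd0 : 0 < d := by linarith
  -- Normalised so that the weights at each vertex sum to `d`; both sides then carry the factor `w³
  -- q / d³`.
  set t : V → V → ℝ := fun u v => d / w * G.weight u v with ht
  set N : V → Finset V := fun u => univ.filter fun v => G.graph.Adj u v with hN
  have hWt : ∀ u v, G.weight u v = w / d * t u v := by
    intro u v; simp only [ht]; field_simp
  have ht0 : ∀ u v, 0 ≤ t u v := fun u v => mul_nonneg (by positivity) (G.weight_nonneg u v)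
  have htN : ∀ u v, v ∉ N u → t u v = 0 := by
    intro u v h
    simp only [hN, mem_filter, mem_univ, true_and] at h
    simp only [ht, G.weight_zero u v h, mul_zero]
  have hsumN : ∀ u, ∑ v ∈ N u, t u v = d := by
    intro u
    rw [sum_subset (subset_univ _) fun v _ h => htN u v h]
    have : ∑ v, G.weight u v = w := hreg u
    simp only [ht, ← mul_sum, this]
    field_simp
  have hsqN : ∀ u, ∑ v ∈ N u, t u v ^ 2 = (d / w) ^ 2 * ∑ v, G.weight u v ^ 2 := by
    intro u
    rw [sum_subset (subset_univ _) fun v _ h => by rw [htN u v h]; norm_num, mul_sum]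
    exact sum_congr rfl fun v _ => by simp only [ht]; ring
  have hlocal := fun u => local_flow_inequality (N u) (t u) hd (fun i _ => ht0 u i) (hsumN u) (by
    rw [hsqN]
    calc (d / w) ^ 2 * ∑ v, G.weight u v ^ 2 ≤ (d / w) ^ 2 * (2 * (w * q / d)) ^ 2 :=
          mul_le_mul_of_nonneg_left (hstar u) (sq_nonneg _)
      _ = 4 * q ^ 2 := by field_simp; ring
      _ = 4 * (d - 1) := by rw [hqq])
  have hπ : ∀ u, w * q / d * ∑ y, G.nbStationary w y u =
      w ^ 3 * q / d ^ 3 * (d ^ 2 - ∑ v ∈ N u, t u v ^ 2) := by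
    intro u
    have h1 : ∑ y, G.nbStationary w y u = w ^ 2 - ∑ v, G.weight u v ^ 2 := by
      have h2 : ∑ v, G.weight u v = w := hreg u
      have h3 : ∀ y, G.nbStationary w y u = w * G.weight u y - G.weight u y ^ 2 := by
        intro y; rw [nbStationary, G.weight_symm y u]; ring
      simp only [h3, sum_sub_distrib, ← mul_sum, h2]; ring
    rw [h1, hsqN]
    field_simp
  have hφ : ∀ u, ∑ v, G.weight u v * G.nbFlow w (G.nbStationary w) u v =
      w ^ 3 * q / d ^ 3 * ∑ v ∈ N u, ∑ y ∈ (N u).erase v,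
        t u v * t u y * √(t u v * ((d - t u y) / (d - 1))) := by
    intro u
    have h1 : ∑ v ∈ N u, ∑ y ∈ (N u).erase v, t u v * t u y * √(t u v * ((d - t u y) / (d - 1))) =
        ∑ v, ∑ y ∈ univ.erase v, t u v * t u y * √(t u v * ((d - t u y) / (d - 1))) := by
      rw [← sum_subset (subset_univ (N u)) fun v _ h => by simp [htN u v h]]
      refine sum_congr rfl fun v _ => sum_subset (erase_subset_erase _ (subset_univ _)) ?_
      intro y hy hy'
      have : y ∉ N u := fun h => hy' (mem_erase.2 ⟨(mem_erase.1 hy).1, h⟩)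
      simp [htN u y this]
    rw [h1, mul_sum]
    refine sum_congr rfl fun v _ => ?_
    rw [nbFlow_nbStationary hw, mul_sum, mul_sum]
    refine sum_congr rfl fun y _ => ?_
    have h2 : G.weight u v * (w - G.weight u y) =
        (w / d * q) ^ 2 * (t u v * ((d - t u y) / (d - 1))) := by
      rw [hWt u v, hWt u y, mul_pow, hqq]
      have : d - 1 ≠ 0 := by linarith
      field_simp
    rw [h2, Real.sqrt_mul (sq_nonneg _), Real.sqrt_sq (by positivity), hWt u v, hWt u y]
    field_simp
  have hcard : ∑ u, ((d : ℝ) - (N u).card) = 0 := by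
    rw [sum_sub_distrib, sum_card_neighbors, hdeg, sum_const, nsmul_eq_mul, card_univ]
    ring
  have hsum := sum_le_sum fun u (_ : u ∈ univ) => hlocal u
  rw [sum_add_distrib, ← mul_sum, hcard, mul_zero, add_zero] at hsum
  rw [mul_sum, sum_congr rfl fun u _ => hπ u, sum_congr rfl fun u _ => hφ u, ← mul_sum, ← mul_sum]
  exact mul_le_mul_of_nonneg_left hsum (by positivity)

/-- Some ball of radius `r` carries a vector whose Rayleigh quotient is at least `w √(d - 1) / d`
times the largest eigenvalue of the path with `r + 1` vertices. -/
theorem exists_ball_rayleigh [Nonempty V] {w d : ℝ} {r : ℕ} (hr : 1 ≤ r) (hw0 : 0 < w)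
    (hreg : G.IsRegular w) (hdeg : G.avgDegree = d) (hd : 39 ≤ d) :
    ∃ (v₀ : V) (g : V → ℝ), g ≠ 0 ∧ (∀ u, g u ≠ 0 → u ∈ G.ball v₀ r) ∧
      w * √(d - 1) / d * (path (r + 1)).eigenvalue 1 * (g ⬝ᵥ g) ≤ g ⬝ᵥ G.adjMatrix *ᵥ g := by
  obtain ⟨hΛ0, hΛ2, x, hx, hx0, hxΛ⟩ := exists_path_eigenvalue r hr
  have hq0 : 0 < √(d - 1) := Real.sqrt_pos.2 (by linarith)
  have hqq : √(d - 1) ^ 2 = d - 1 := Real.sq_sqrt (by linarith)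
  have hθ0 : 0 < w * √(d - 1) / d := by positivity
  -- Since `Λ ≤ 2`, a star above this threshold already suffices. Below it every weight is less than
  -- `w`, as `2√(d - 1) < d`, so the walk is well defined.
  by_cases hstar : ∀ u, ∑ v, G.weight u v ^ 2 ≤ (2 * (w * √(d - 1) / d)) ^ 2
  · have hw : ∀ u v, G.weight u v < w := by
      intro u v
      have h1 : G.weight u v ^ 2 ≤ (2 * (w * √(d - 1) / d)) ^ 2 :=
        (single_le_sum (f := fun v => G.weight u v ^ 2) (fun i _ => sq_nonneg _)
          (mem_univ v)).trans (hstar u)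
      have h2 : G.weight u v ≤ 2 * (w * √(d - 1) / d) :=
        (abs_le_of_sq_le_sq' h1 (by positivity)).2
      have h3 : 2 * (w * √(d - 1) / d) < w := by
        have h4 : 2 * √(d - 1) < d := by nlinarith
        rw [mul_div_assoc', div_lt_iff₀ (by linarith)]
        nlinarith
      linarith
    refine exists_ball_vector hreg hw hΛ0.le hx hx0 hxΛ ?_ hθ0.le
      (flow_inequality hw0 hreg hw hdeg hd hstar)
    obtain ⟨u⟩ := ‹Nonempty V›
    have hsum : ∑ y, G.weight u y = w := hreg u
    obtain ⟨y, -, hy⟩ := exists_ne_zero_of_sum_ne_zero (hsum.trans_ne hw0.ne')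
    have hnn : ∀ u y, 0 ≤ G.nbStationary w y u := fun u y =>
      mul_nonneg (G.weight_nonneg y u) (sub_nonneg.2 (hw y u).le)
    refine sum_pos' (fun u _ => sum_nonneg fun y _ => hnn u y) ⟨u, mem_univ u, ?_⟩
    refine sum_pos' (fun y _ => hnn u y) ⟨y, mem_univ y, mul_pos ?_ (sub_pos.2 (hw y u))⟩
    rw [G.weight_symm y u]
    exact lt_of_le_of_ne (G.weight_nonneg u y) hy.symm
  · push Not at hstar
    obtain ⟨v, hv⟩ := hstar
    have h1 : 2 * (w * √(d - 1) / d) ≤ √(∑ u, G.weight v u ^ 2) := Real.le_sqrt_of_sq_le hv.le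
    obtain ⟨g, hg⟩ := exists_star_vector (θ := w * √(d - 1) / d * (path (r + 1)).eigenvalue 1) v
      ((sq_nonneg _).trans_lt hv) (by nlinarith) hr
    exact ⟨v, g, hg⟩

/-- The indicator vector of a set of large minimum degree. -/
theorem indicator_rayleigh {δ : ℝ} (S : Finset V)
    (hS : ∀ u : (S : Set V), δ ≤ (G.induce (S : Set V)).weightedDegree u) :
    δ * ((fun u => if u ∈ S then (1 : ℝ) else 0) ⬝ᵥ fun u => if u ∈ S then (1 : ℝ) else 0) ≤
      (fun u => if u ∈ S then (1 : ℝ) else 0) ⬝ᵥ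
        G.adjMatrix *ᵥ fun u => if u ∈ S then (1 : ℝ) else 0 := by
  rw [dotProduct_adjMatrix_mulVec, dotProduct, mul_sum]
  refine sum_le_sum fun u _ => ?_
  by_cases hu : u ∈ S
  · have h1 : (G.induce (S : Set V)).weightedDegree ⟨u, hu⟩ = ∑ v ∈ S, G.weight u v := by
      rw [weightedDegree]
      exact sum_coe_sort S fun v => G.weight u v
    have h2 := hS ⟨u, hu⟩
    rw [h1] at h2
    simpa [hu] using h2
  · simp [hu]

end WeightedGraph

theorem mainTheorem4 {V : Type*} [Fintype V] [DecidableEq V] (G : WeightedGraph V)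
    (w d : ℝ) (r : ℕ) (hr : 1 ≤ r)
    (hreg : G.IsRegular w)
    (hdeg : G.avgDegree = d) (hd : 39 ≤ d)
    (hsub : ∀ v : V, ∃ S : Finset V, S.Nonempty ∧
      (S : Set V) ⊆ (G.ball v (r + 1))ᶜ ∧
      ∀ u : (S : Set V),
        2 * w * Real.sqrt (d - 1) / d ≤ (G.induce (S : Set V)).weightedDegree u) :
    w * Real.sqrt (d - 1) / d ≤
      G.eigenvalue 2 / (WeightedGraph.path (r + 1)).eigenvalue 1 := by
  classical
  -- Without edges the average degree would be `0`, also when `V` is empty.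
  have hne : G.graph.edgeSet.Nonempty := by
    rw [Set.nonempty_iff_ne_empty]
    intro h
    rw [WeightedGraph.avgDegree, h] at hdeg
    simp at hdeg
    linarith
  obtain ⟨a, b, hab⟩ : ∃ a b, G.graph.Adj a b := by
    obtain ⟨e, he⟩ := hne
    induction e using Sym2.ind with
    | h a b => exact ⟨a, b, he⟩
  have : Nonempty V := ⟨a⟩
  have hcard : 1 < Fintype.card V := Fintype.one_lt_card_iff.2 ⟨a, b, hab.ne⟩
  have hw0 : 0 < w := by
    rw [← hreg a]
    exact Finset.sum_pos' (fun u _ => G.weight_nonneg a u)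
      ⟨b, Finset.mem_univ b, G.weight_pos a b hab⟩
  obtain ⟨hΛ0, hΛ2, -⟩ := WeightedGraph.exists_path_eigenvalue r hr
  have hθ0 : 0 ≤ w * √(d - 1) / d := by
    have : 0 ≤ d := by linarith
    positivity
  obtain ⟨v, g, hg0, hgb, hg⟩ := WeightedGraph.exists_ball_rayleigh hr hw0 hreg hdeg hd
  obtain ⟨S, ⟨z, hz⟩, hSb, hS⟩ := hsub v
  have hs := G.indicator_rayleigh S hS
  have hSout : ∀ u ∈ S, u ∉ G.ball v (r + 1) := fun u hu => hSb hu
  have hE : G.eigenvalue 2 = G.adjMatrix_isHermitian.eigenvalues₀ ⟨1, hcard⟩ :=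
    dif_pos ⟨one_le_two, hcard⟩
  rw [le_div_iff₀ hΛ0, hE]
  refine G.adjMatrix_isHermitian.le_eigenvalues₀_one hcard hg0 (s := fun u => if u ∈ S then 1 else 0)
    (fun h => ?_) ?_ ?_ hg (le_trans (mul_le_mul_of_nonneg_right ?_ ?_) hs)
  · have := congrFun h z
    simp [hz] at this
  · refine Finset.sum_eq_zero fun u _ => ?_
    by_cases hu : u ∈ S
    · have : g u = 0 := by
        by_contra h
        exact hSout u hu (WeightedGraph.ball_mono (Nat.le_succ r) (hgb u h))
      simp [this]
    · simp [hu]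
  -- A neighbour of the ball of radius `r` lies in the ball of radius `r + 1`, hence outside `S`.
  · refine Finset.sum_eq_zero fun u _ => ?_
    by_contra h
    obtain ⟨y, -, hy⟩ := Finset.exists_ne_zero_of_sum_ne_zero (right_ne_zero_of_mul h)
    have hyS : y ∈ S := by
      by_contra hyS
      simp [hyS] at hy
    exact hSout y hyS (WeightedGraph.mem_ball_succ (hgb u (left_ne_zero_of_mul h))
      (left_ne_zero_of_mul hy))
  · have h2 : 2 * w * √(d - 1) / d = w * √(d - 1) / d * 2 := by ring
    rw [h2]
    exact mul_le_mul_of_nonneg_left hΛ2 hθ0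
  · exact Finset.sum_nonneg fun u _ => mul_self_nonneg _
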